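/- Let $\mathbb{D}=\{z\in\mathbb{C}:|z|<1\}$, and let $w:\mathbb{D}\to(0,\infty]$ be a positive superharmonic function, that is, $w$ is lower semicontinuous and for every $z\in\mathbb{D}$ there is $\rho>0$ such that $\{|\zeta-z|<\rho\}\subset\mathbb{D}$ and \[ \frac1{2\pi}\int_0^{2\pi}w(z+re^{i\theta})\,d\theta\le w(z)\qquad(0<r<\rho). \] Let $\mathcal{D}_w$ be the set of all holomorphic functions $f:\mathbb{D}\to\mathbb{C}$ such that \[ \mathcal{D}_w(f):=\frac1\pi\int_{\mathbb{D}}|f'(z)|^2\,w(z)\,dA(z)<\infty, \] where $dA$ is the area measure. Then $\mathcal{D}_w$ contains a function $f$ with $f(\mathbb{D})=\mathbb{C}$ if and only if $\inf_{z\in\mathbb{D}}w(z)=0$. -/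

import Mathlib

open MeasureTheory
open scoped ENNReal

/-- The open unit disk in `ℂ`. -/
def unitDisk : Set ℂ := Metric.ball (0 : ℂ) 1

/-- The mean of a `[0, ∞]`-valued function over the circle with center `z` and radius `r`. -/
noncomputable def circleMean (w : ℂ → ℝ≥0∞) (z : ℂ) (r : ℝ) : ℝ≥0∞ :=
  (ENNReal.ofReal (2 * Real.pi))⁻¹ *
    ∫⁻ θ in Set.Ioc (0 : ℝ) (2 * Real.pi), w (circleMap z r θ)

/-- Positive superharmonic functions on a set `U` (meant to be open), as functions with values in
`(0, ∞]`: lower semicontinuous on `U`, and satisfying the local super-mean-value inequality at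
every point of `U`. Only the values of `w` on `U` matter. The constant `∞` is not excluded. -/
structure IsPositiveSuperharmonicOn (w : ℂ → ℝ≥0∞) (U : Set ℂ) : Prop where
  pos : ∀ z ∈ U, 0 < w z
  lowerSemicontinuousOn : LowerSemicontinuousOn w U
  circleMean_le : ∀ z ∈ U, ∃ ρ : ℝ, 0 < ρ ∧ Metric.ball z ρ ⊆ U ∧
    ∀ r : ℝ, 0 < r → r < ρ → circleMean w z r ≤ w z

/-- The weighted Dirichlet integral `(1/π) ∫_𝔻 |f'|² w dA`, with values in `[0, ∞]`. -/
noncomputable def dirichletIntegral (w : ℂ → ℝ≥0∞) (f : ℂ → ℂ) : ℝ≥0∞ :=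
  (ENNReal.ofReal Real.pi)⁻¹ * ∫⁻ z in unitDisk, ‖deriv f z‖ₑ ^ 2 * w z

/-- The weighted Dirichlet space `𝒟_w`: functions that are holomorphic on the unit disk and have
finite weighted Dirichlet integral. (The values outside the disk are irrelevant.) -/
def dirichletSpace (w : ℂ → ℝ≥0∞) : Set (ℂ → ℂ) :=
  {f | DifferentiableOn ℂ f unitDisk ∧ dirichletIntegral w f < ∞}

/-!
If `w ≥ c > 0` on the disk, then a function in `𝒟_w` has image of finite area, so it is not onto.

Conversely, let `φ_a` be the involution of the disk exchanging `0` and `a`. The function `w ∘ φ_a`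
is again superharmonic: compare `w` with harmonic functions on the images of disks. Substituting
`z = φ_a ζ` and integrating the circle means of `w ∘ φ_a` in polar coordinates gives
`𝒟_w(φ_a) ≤ w(a)`. Hence the bump `R φ_a (φ_a - a)` costs at most `9 R² w(a)`, while near `a` it
covers a disk of radius comparable to `R`. When `inf w = 0`, lower semicontinuity and positivity
force `w` to be small only close to the unit circle, so there are points `a_k` tending to the circle
as fast as we like with `w(a_k)` as small as we like. For rapidly growing heights `R_k` the sum of
the bumps then belongs to `𝒟_w`, and near `a_k` it is a small perturbation of the `k`-th bump; hence
it covers a disk about `0` of radius `R_k / 32`.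
-/

open Set Metric Filter Topology InnerProductSpace
open scoped NNReal ComplexConjugate

/-! ### Lower semicontinuous functions -/

section LowerSemicontinuous

variable {X : Type*} [PseudoEMetricSpace X]

theorem continuous_biInf_add_mul_edist (f : X → ℝ≥0∞) (s : Set X) (n : ℕ) :
    Continuous fun x => ⨅ y ∈ s, f y + n * edist x y := by
  refine continuous_of_le_add_edist n (ENNReal.natCast_ne_top n) fun x x' => ?_
  simp only [ENNReal.iInf_add]
  refine iInf₂_mono fun y _ => ?_
  calc f y + n * edist x y ≤ f y + n * (edist x x' + edist x' y) := by
        gcongr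
        exact edist_triangle x x' y
    _ = f y + n * edist x' y + n * edist x x' := by ring

theorem exists_le_biInf_add_mul_edist {f : X → ℝ≥0∞} {s : Set X}
    (hf : LowerSemicontinuousOn f s) {x : X} (hx : x ∈ s) {d : ℝ≥0∞} (hd : d < f x) :
    ∃ n : ℕ, d ≤ ⨅ y ∈ s, f y + n * edist x y := by
  obtain ⟨δ, hδ, hball⟩ := EMetric.mem_nhdsWithin_iff.1 (hf x hx d hd)
  obtain ⟨n, hn⟩ := ENNReal.exists_nat_gt (ENNReal.div_ne_top hd.ne_top hδ.ne')
  refine ⟨n, le_iInf₂ fun y hy => ?_⟩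
  rcases lt_or_ge (edist x y) δ with hxy | hxy
  · exact le_add_right (hball ⟨by rwa [mem_eball'], hy⟩).le
  · refine le_add_left (le_trans ?_ (mul_le_mul_right hxy _))
    exact (ENNReal.div_le_iff_le_mul (.inl hδ.ne') (.inr (pos_of_gt hn).ne')).1 hn.le

theorem exists_monotone_continuous_iSup_eq {f : X → ℝ≥0∞} {s : Set X}
    (hf : LowerSemicontinuousOn f s) :
    ∃ g : ℕ → X → ℝ≥0, (∀ n, Continuous (g n)) ∧ Monotone g ∧
      ∀ x ∈ s, ⨆ n, (g n x : ℝ≥0∞) = f x := by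
  have hfin (n : ℕ) (x : X) : (⨅ y ∈ s, f y + n * edist x y) ⊓ n ≠ ∞ :=
    (inf_le_right.trans_lt (ENNReal.natCast_lt_top n)).ne
  refine ⟨fun n x => ((⨅ y ∈ s, f y + n * edist x y) ⊓ n).toNNReal, fun n => ?_,
    fun m n hmn x => ?_, fun x hx => ?_⟩
  · exact ENNReal.continuousOn_toNNReal.comp_continuous
      ((continuous_biInf_add_mul_edist f s n).inf continuous_const) (hfin n)
  · refine ENNReal.toNNReal_mono (hfin n x) ?_
    gcongr
  · simp only [ENNReal.coe_toNNReal (hfin _ x)]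
    refine le_antisymm (iSup_le fun n => ?_) (le_of_forall_lt fun d hd => ?_)
    · exact inf_le_left.trans ((iInf₂_le x hx).trans (by simp))
    · obtain ⟨e, hde, he⟩ := exists_between hd
      obtain ⟨m, hm⟩ := exists_le_biInf_add_mul_edist hf hx he
      obtain ⟨n, hn⟩ := ENNReal.exists_nat_gt he.ne_top
      refine hde.trans_le (le_iSup_of_le (max m n) (le_inf (hm.trans ?_) (hn.le.trans ?_)))
      · gcongr
        exact le_max_left m n
      · gcongr
        exact le_max_right m n

theorem exists_measurable_eqOn [MeasurableSpace X] [OpensMeasurableSpace X] {f : X → ℝ≥0∞}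
    {s : Set X} (hf : LowerSemicontinuousOn f s) : ∃ g, Measurable g ∧ EqOn g f s := by
  obtain ⟨g, hg, -, hgf⟩ := exists_monotone_continuous_iSup_eq hf
  exact ⟨fun x => ⨆ n, (g n x : ℝ≥0∞),
    .iSup fun n => (ENNReal.continuous_coe.comp (hg n)).measurable, hgf⟩

end LowerSemicontinuous

/-! ### Circle means -/

section CircleMean

variable {v w : ℂ → ℝ≥0∞} {c : ℂ} {r : ℝ}

theorem circleMean_mono (hr : 0 ≤ r) (h : ∀ z ∈ sphere c r, v z ≤ w z) :
    circleMean v c r ≤ circleMean w c r := by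
  unfold circleMean
  gcongr with θ
  exact h _ (circleMap_mem_sphere c hr θ)

theorem circleMean_congr (hr : 0 ≤ r) (h : EqOn v w (sphere c r)) :
    circleMean v c r = circleMean w c r :=
  le_antisymm (circleMean_mono hr fun _ hz => (h hz).le)
    (circleMean_mono hr fun _ hz => (h hz).ge)

theorem circleMean_const (a : ℝ≥0∞) (c : ℂ) (r : ℝ) : circleMean (fun _ => a) c r = a := by
  have h0 := (ENNReal.ofReal_pos.2 Real.two_pi_pos).ne'
  rw [circleMean, setLIntegral_const, Real.volume_Ioc, sub_zero, mul_comm a, ← mul_assoc,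
    ENNReal.inv_mul_cancel h0 ENNReal.ofReal_ne_top, one_mul]

theorem circleMean_ofReal {p : ℂ → ℝ} (hr : 0 ≤ r) (hp : ContinuousOn p (sphere c r))
    (h0 : ∀ z ∈ sphere c r, 0 ≤ p z) :
    circleMean (fun z => ENNReal.ofReal (p z)) c r = ENNReal.ofReal (Real.circleAverage p c r) := by
  have hcont : Continuous fun θ => p (circleMap c r θ) :=
    hp.comp_continuous (continuous_circleMap c r) (circleMap_mem_sphere c hr)
  rw [Real.circleAverage_def, smul_eq_mul, ENNReal.ofReal_mul (by positivity),
    ENNReal.ofReal_inv_of_pos Real.two_pi_pos, intervalIntegral.integral_of_le Real.two_pi_pos.le,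
    ofReal_integral_eq_lintegral_ofReal
      ((hcont.intervalIntegrable _ _).1)
      (ae_of_all _ fun θ => h0 _ (circleMap_mem_sphere c hr θ)), circleMean]

theorem circleMean_add_ofReal {p : ℂ → ℝ} (hr : 0 ≤ r) (hp : ContinuousOn p (sphere c r))
    (h0 : ∀ z ∈ sphere c r, 0 ≤ p z) :
    circleMean (fun z => w z + ENNReal.ofReal (p z)) c r =
      circleMean w c r + ENNReal.ofReal (Real.circleAverage p c r) := by
  have hcont : Continuous fun θ => p (circleMap c r θ) :=
    hp.comp_continuous (continuous_circleMap c r) (circleMap_mem_sphere c hr)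
  rw [← circleMean_ofReal hr hp h0, circleMean, circleMean, circleMean,
    lintegral_add_right _ hcont.measurable.ennreal_ofReal, mul_add]

theorem circleMean_le_of_forall_continuous_le {M : ℝ≥0∞} (hr : 0 ≤ r)
    (hv : LowerSemicontinuousOn v (sphere c r))
    (h : ∀ g : ℂ → ℝ≥0, Continuous g → (∀ z ∈ sphere c r, (g z : ℝ≥0∞) ≤ v z) →
      circleMean (fun z => g z) c r ≤ M) :
    circleMean v c r ≤ M := by
  obtain ⟨g, hg, hmono, hgv⟩ := exists_monotone_continuous_iSup_eq hv
  have hlim : circleMean v c r = ⨆ n, circleMean (fun z => g n z) c r := by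
    rw [← circleMean_congr hr hgv]
    simp only [circleMean]
    rw [lintegral_iSup, ENNReal.mul_iSup]
    · exact fun n =>
        (ENNReal.continuous_coe.comp ((hg n).comp (continuous_circleMap c r))).measurable
    · exact fun m n hmn θ => ENNReal.coe_le_coe.2 (hmono hmn _)
  rw [hlim]
  exact iSup_le fun n => h (g n) (hg n) fun z hz => hgv z hz ▸ le_iSup (fun n => (g n z : ℝ≥0∞)) n

end CircleMean

theorem circleAverage_norm_sq (c : ℂ) (r : ℝ) :
    Real.circleAverage (fun z => ‖z‖ ^ 2) c r = ‖c‖ ^ 2 + r ^ 2 := by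
  let G : ℂ → ℂ := fun z => ↑(‖c‖ ^ 2 + r ^ 2) + 2 * (conj c * (z - c))
  have hG : HarmonicOnNhd (fun z => (G z).re) (closedBall c |r|) := fun z _ =>
    ((by fun_prop : Differentiable ℂ G).analyticAt z).harmonicAt_re
  have heq : EqOn (fun z => ‖z‖ ^ 2) (fun z => (G z).re) (sphere c |r|) := fun z hz => by
    have hz : ‖z - c‖ ^ 2 = r ^ 2 := by rw [mem_sphere_iff_norm.1 hz, sq_abs]
    simp only [G, Complex.add_re, Complex.ofReal_re, ← hz]
    simp only [← Complex.normSq_eq_norm_sq, Complex.normSq_apply, Complex.mul_re, Complex.mul_im,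
      Complex.sub_re, Complex.sub_im, Complex.conj_re, Complex.conj_im, Complex.re_ofNat,
      Complex.im_ofNat]
    ring
  rw [Real.circleAverage_congr_sphere heq, hG.circleAverage_eq]
  simp [G, -Complex.ofReal_add, -Complex.ofReal_pow]

/-! ### The minimum principle -/

theorem IsPositiveSuperharmonicOn.not_isLocalMin_add_ofReal {w : ℂ → ℝ≥0∞} {U : Set ℂ}
    (hw : IsPositiveSuperharmonicOn w U) {x : ℂ} (hx : x ∈ U) (hwx : w x ≠ ∞) {p : ℂ → ℝ}
    (hp : ∀ᶠ y in 𝓝 x, ContinuousAt p y ∧ 0 ≤ p y)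
    (havg : ∀ᶠ s in 𝓝[>] 0, Real.circleAverage p x s < p x) :
    ¬ IsLocalMin (fun y => w y + ENNReal.ofReal (p y)) x := by
  intro hmin
  obtain ⟨ρ, hρ, -, hmean⟩ := hw.circleMean_le x hx
  obtain ⟨σ, hσ, hpσ⟩ := Metric.eventually_nhds_iff_ball.1 (hp.and hmin)
  obtain ⟨s, hs, hs0, hsρσ⟩ := (havg.and (Ioo_mem_nhdsGT (lt_min hρ hσ))).exists
  have hpσ : ∀ z ∈ sphere x s, (ContinuousAt p z ∧ 0 ≤ p z) ∧
      w x + ENNReal.ofReal (p x) ≤ w z + ENNReal.ofReal (p z) := fun z hz =>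
    hpσ z (mem_ball.2 ((mem_sphere.1 hz).trans_lt (hsρσ.trans_le (min_le_right _ _))))
  have hcont : ContinuousOn p (sphere x s) := fun z hz => (hpσ z hz).1.1.continuousWithinAt
  have hpos : 0 ≤ Real.circleAverage p x s :=
    Real.circleAverage_nonneg_of_nonneg fun z hz => (hpσ z (by rwa [abs_of_pos hs0] at hz)).1.2
  refine lt_irrefl (w x + ENNReal.ofReal (p x)) ?_
  calc w x + ENNReal.ofReal (p x)
      = circleMean (fun _ => w x + ENNReal.ofReal (p x)) x s := (circleMean_const _ _ _).symm
    _ ≤ circleMean (fun y => w y + ENNReal.ofReal (p y)) x s :=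
        circleMean_mono hs0.le fun z hz => (hpσ z hz).2
    _ = circleMean w x s + ENNReal.ofReal (Real.circleAverage p x s) :=
        circleMean_add_ofReal hs0.le hcont fun z hz => (hpσ z hz).1.2
    _ ≤ w x + ENNReal.ofReal (Real.circleAverage p x s) := by
        gcongr
        exact hmean s hs0 (hsρσ.trans_le (min_le_left _ _))
    _ < w x + ENNReal.ofReal (p x) :=
        ENNReal.add_lt_add_left hwx ((ENNReal.ofReal_lt_ofReal_iff_of_nonneg hpos).2 hs)

theorem IsPositiveSuperharmonicOn.exists_mem_frontier_add_ofReal_le {w : ℂ → ℝ≥0∞} {U : Set ℂ}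
    (hw : IsPositiveSuperharmonicOn w U) {K : Set ℂ} (hK : IsCompact K) (hKU : K ⊆ U) {p : ℂ → ℝ}
    (hp : ∀ x ∈ K, ContinuousAt p x ∧ 0 ≤ p x)
    (havg : ∀ x ∈ interior K, ∀ᶠ s in 𝓝[>] 0, Real.circleAverage p x s < p x)
    {x : ℂ} (hx : x ∈ K) (hwx : w x ≠ ∞) :
    ∃ y ∈ frontier K, w y + ENNReal.ofReal (p y) ≤ w x + ENNReal.ofReal (p x) := by
  have hlsc : LowerSemicontinuousOn (fun y => w y + ENNReal.ofReal (p y)) K :=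
    (hw.lowerSemicontinuousOn.mono hKU).add (ENNReal.continuous_ofReal.comp_continuousOn
      fun y hy => (hp y hy).1.continuousWithinAt).lowerSemicontinuousOn
  obtain ⟨y, hy, hmin⟩ := hlsc.exists_isMinOn ⟨x, hx⟩ hK
  refine ⟨y, ⟨subset_closure hy, fun hyint => ?_⟩, hmin hx⟩
  have hKy : K ∈ 𝓝 y := mem_interior_iff_mem_nhds.1 hyint
  have hwy : w y < ∞ := (le_self_add.trans (hmin hx)).trans_lt
    (ENNReal.add_lt_top.2 ⟨hwx.lt_top, ENNReal.ofReal_lt_top⟩)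
  exact hw.not_isLocalMin_add_ofReal (hKU hy) hwy.ne (mem_of_superset hKy hp) (havg y hyint)
    (hmin.isLocalMin hKy)

theorem circleAverage_sub_mul_norm_sq_lt {u : ℂ → ℝ} {c : ℂ} {r ε : ℝ} (hr : 0 < r) (hε : 0 < ε)
    (hu : HarmonicOnNhd u (closedBall c r)) :
    Real.circleAverage (fun z => u z - ε * ‖z‖ ^ 2) c r < u c - ε * ‖c‖ ^ 2 := by
  calc Real.circleAverage (fun z => u z - ε * ‖z‖ ^ 2) c r
      = u c - ε * (‖c‖ ^ 2 + r ^ 2) := by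
        rw [Real.circleAverage_fun_sub
          ((hu.continuousOn.mono sphere_subset_closedBall).circleIntegrable hr.le)
          (by fun_prop : Continuous fun z : ℂ => ε * ‖z‖ ^ 2).continuousOn.circleIntegrable',
          InnerProductSpace.HarmonicOnNhd.circleAverage_eq (by rwa [abs_of_pos hr])]
        simp_rw [← smul_eq_mul]
        rw [Real.circleAverage_fun_smul, circleAverage_norm_sq]
    _ < u c - ε * ‖c‖ ^ 2 := by
        have : 0 < ε * r ^ 2 := by positivity
        linarith

theorem exists_pos_mul_norm_sq_le {E : Type*} [SeminormedAddGroup E] {s : Set E}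
    (hs : Bornology.IsBounded s) {δ : ℝ} (hδ : 0 < δ) : ∃ ε > 0, ∀ x ∈ s, ε * ‖x‖ ^ 2 ≤ δ := by
  obtain ⟨B, hB, hsB⟩ := hs.exists_pos_norm_le
  refine ⟨δ / B ^ 2, by positivity, fun x hx => ?_⟩
  rw [div_mul_eq_mul_div, div_le_iff₀ (by positivity)]
  gcongr
  exact hsB x hx

theorem IsPositiveSuperharmonicOn.ofReal_le_of_frontier {w : ℂ → ℝ≥0∞} {U : Set ℂ}
    (hw : IsPositiveSuperharmonicOn w U) {K : Set ℂ} (hK : IsCompact K) (hKU : K ⊆ U)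
    {h : ℂ → ℝ} (hh : HarmonicOnNhd h K) (hle : ∀ x ∈ frontier K, ENNReal.ofReal (h x) ≤ w x) :
    ∀ x ∈ K, ENNReal.ofReal (h x) ≤ w x := by
  by_contra! hcon
  obtain ⟨x, hx, hlt⟩ := hcon
  obtain ⟨t, ht0, hwt, hth⟩ := ENNReal.lt_iff_exists_real_btwn.1 hlt
  replace hth : t < h x := (ENNReal.ofReal_lt_ofReal_iff_of_nonneg ht0).1 hth
  obtain ⟨ε, hε, hεK⟩ := exists_pos_mul_norm_sq_le hK.isBounded (sub_pos.2 hth)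
  obtain ⟨N, hN⟩ : ∃ N, ∀ y ∈ K, h y + ε * ‖y‖ ^ 2 ≤ N := by
    obtain ⟨N, hN⟩ := (hK.image_of_continuousOn
      (hh.continuousOn.add (g := fun y => ε * ‖y‖ ^ 2) (by fun_prop))).bddAbove
    exact ⟨N, fun y hy => hN (mem_image_of_mem _ hy)⟩
  -- The quadratic term makes `p` strictly superharmonic, and `N` makes it nonnegative, so that it
  -- can be added to the `ℝ≥0∞`-valued `w`.
  let p : ℂ → ℝ := fun y => N - h y - ε * ‖y‖ ^ 2
  have hp : ∀ y ∈ K, ContinuousAt p y ∧ 0 ≤ p y := fun y hy => by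
    have := (hh y hy).1.continuousAt
    exact ⟨by fun_prop, by linarith [hN y hy]⟩
  have havg : ∀ y ∈ interior K, ∀ᶠ s in 𝓝[>] 0, Real.circleAverage p y s < p y := fun y hy => by
    obtain ⟨σ, hσ, hσK⟩ := Metric.nhds_basis_closedBall.mem_iff.1 (mem_interior_iff_mem_nhds.1 hy)
    filter_upwards [Ioc_mem_nhdsGT hσ] with s hs
    exact circleAverage_sub_mul_norm_sq_lt hs.1 hε <| (harmonicOnNhd_const N).sub
      (hh.mono ((closedBall_subset_closedBall hs.2).trans hσK))
  obtain ⟨y, hy, hyx⟩ := hw.exists_mem_frontier_add_ofReal_le hK hKU hp havg hx hlt.ne_top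
  have hyK : y ∈ K := hK.isClosed.frontier_subset hy
  refine lt_irrefl (ENNReal.ofReal (N - (h x - t))) ?_
  calc ENNReal.ofReal (N - (h x - t))
      ≤ ENNReal.ofReal (h y + p y) := ENNReal.ofReal_le_ofReal (by linarith [hεK y hyK])
    _ ≤ ENNReal.ofReal (h y) + ENNReal.ofReal (p y) := ENNReal.ofReal_add_le
    _ ≤ w y + ENNReal.ofReal (p y) := by
        gcongr
        exact hle y hy
    _ ≤ w x + ENNReal.ofReal (p x) := hyx
    _ < ENNReal.ofReal t + ENNReal.ofReal (p x) :=
        ENNReal.add_lt_add_right ENNReal.ofReal_ne_top hwt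
    _ = ENNReal.ofReal (t + p x) := (ENNReal.ofReal_add ht0 (hp x hx).2).symm
    _ ≤ ENNReal.ofReal (N - (h x - t)) :=
        ENNReal.ofReal_le_ofReal (by linarith [mul_nonneg hε.le (sq_nonneg ‖x‖)])

/-! ### Conformal invariance of the mean value inequality -/

theorem exists_differentiable_re_eq_re_mul_fourier (a c : ℂ) {r : ℝ} (hr : r ≠ 0) (n : ℤ) :
    ∃ G : ℂ → ℂ, Differentiable ℂ G ∧ ∀ θ : ℝ,
      (a * fourier n (θ : AddCircle (2 * Real.pi))).re = (G (circleMap c r θ)).re := by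
  have hunit : ∀ θ : ℝ, (circleMap c r θ - c) / r = Complex.exp (θ * Complex.I) := fun θ => by
    rw [circleMap_sub_center, circleMap_zero, mul_div_cancel_left₀ _ (by exact_mod_cast hr)]
  have hfourier : ∀ θ : ℝ, fourier n (θ : AddCircle (2 * Real.pi)) =
      Complex.exp (θ * Complex.I) ^ n := fun θ => by
    rw [fourier_coe_apply, ← Complex.exp_int_mul]
    congr 1
    push_cast
    field_simp
  obtain ⟨m, rfl | rfl⟩ := n.eq_nat_or_neg
  · refine ⟨fun z => a * ((z - c) / r) ^ m, by fun_prop, fun θ => ?_⟩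
    simp only [hfourier, hunit, zpow_natCast]
  · refine ⟨fun z => conj a * ((z - c) / r) ^ m, by fun_prop, fun θ => ?_⟩
    simp only [hfourier, hunit]
    rw [← Complex.conj_re]
    simp [← Complex.exp_conj, Complex.exp_neg]

theorem exists_differentiable_abs_sub_re_lt {g : ℂ → ℝ} {c : ℂ} {r ε : ℝ} (hr : 0 < r)
    (hε : 0 < ε) (hg : ContinuousOn g (sphere c r)) :
    ∃ G : ℂ → ℂ, Differentiable ℂ G ∧ ∀ z ∈ sphere c r, |g z - (G z).re| < ε := by
  have : Fact (0 < 2 * Real.pi) := ⟨Real.two_pi_pos⟩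
  have hcont : Continuous fun θ : ℝ => (g (circleMap c r θ) : ℂ) :=
    Complex.continuous_ofReal.comp
      (hg.comp_continuous (continuous_circleMap c r) (circleMap_mem_sphere c hr.le))
  have hper : Function.Periodic (fun θ : ℝ => (g (circleMap c r θ) : ℂ)) (2 * Real.pi) :=
    fun θ => by simp only [periodic_circleMap c r θ]
  let γ : C(AddCircle (2 * Real.pi), ℂ) := ⟨hper.lift, continuous_coinduced_dom.2 hcont⟩
  have hγ : γ ∈ (Submodule.span ℂ (range (@fourier (2 * Real.pi)))).topologicalClosure := by
    rw [span_fourier_closure_eq_top]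
    exact Submodule.mem_top
  obtain ⟨F, hF, hγF⟩ := Metric.mem_closure_iff.1 hγ ε hε
  obtain ⟨G, hG, hFG⟩ : ∃ G : ℂ → ℂ, Differentiable ℂ G ∧
      ∀ θ : ℝ, (F (θ : AddCircle (2 * Real.pi))).re = (G (circleMap c r θ)).re := by
    clear hγF
    induction hF using Submodule.closure_induction with
    | zero => exact ⟨0, differentiable_const 0, by simp⟩
    | add F₁ F₂ _ _ h₁ h₂ =>
      obtain ⟨G₁, hG₁, hFG₁⟩ := h₁
      obtain ⟨G₂, hG₂, hFG₂⟩ := h₂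
      exact ⟨G₁ + G₂, hG₁.add hG₂, fun θ => by simp [hFG₁, hFG₂]⟩
    | smul_mem a F hF =>
      obtain ⟨n, rfl⟩ := hF
      exact exists_differentiable_re_eq_re_mul_fourier a c hr.ne' n
  refine ⟨G, hG, fun z hz => ?_⟩
  rw [← abs_of_pos hr, ← range_circleMap] at hz
  obtain ⟨θ, rfl⟩ := hz
  calc |g (circleMap c r θ) - (G (circleMap c r θ)).re|
      = |(γ θ - F θ).re| := by rw [Complex.sub_re, hFG]; rfl
    _ ≤ ‖(γ - F) θ‖ := Complex.abs_re_le_norm _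
    _ ≤ dist γ F := by rw [dist_eq_norm]; exact (γ - F).norm_coe_le_norm θ
    _ < ε := hγF

theorem frontier_image_closedBall_subset {φ ψ : ℂ → ℂ} {U : Set ℂ} {c : ℂ} {r : ℝ}
    (hU : IsOpen U) (hφ : ContinuousOn φ (closedBall c r)) (hmaps : MapsTo φ (closedBall c r) U)
    (hψ : ContinuousOn ψ U) (hinv : InvOn ψ φ (closedBall c r) U) :
    frontier (φ '' closedBall c r) ⊆ φ '' sphere c r := by
  have himage : φ '' ball c r = U ∩ ψ ⁻¹' ball c r := by
    ext x
    constructor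
    · rintro ⟨z, hz, rfl⟩
      have hz' := ball_subset_closedBall hz
      exact ⟨hmaps hz', by rwa [mem_preimage, hinv.1 hz']⟩
    · exact fun ⟨hx, hψx⟩ => ⟨ψ x, hψx, hinv.2 hx⟩
  have hopen : IsOpen (φ '' ball c r) := himage ▸ hψ.isOpen_inter_preimage hU isOpen_ball
  have hK : IsClosed (φ '' closedBall c r) :=
    ((isCompact_closedBall c r).image_of_continuousOn hφ).isClosed
  rw [hK.frontier_eq]
  rintro _ ⟨⟨z, hz, rfl⟩, hint⟩
  refine mem_image_of_mem φ ((mem_closedBall.1 hz).eq_or_lt.resolve_right fun hlt => hint ?_)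
  exact interior_maximal (image_mono ball_subset_closedBall) hopen (mem_image_of_mem φ hlt)

theorem IsPositiveSuperharmonicOn.ofReal_re_le_comp {w : ℂ → ℝ≥0∞} {U : Set ℂ}
    (hw : IsPositiveSuperharmonicOn w U) (hU : IsOpen U) {φ ψ : ℂ → ℂ} {c : ℂ} {r : ℝ}
    (hr : 0 ≤ r) (hφ : ContinuousOn φ (closedBall c r)) (hmaps : MapsTo φ (closedBall c r) U)
    (hψ : DifferentiableOn ℂ ψ U) (hinv : InvOn ψ φ (closedBall c r) U) {G : ℂ → ℂ}
    (hG : Differentiable ℂ G) (hle : ∀ z ∈ sphere c r, ENNReal.ofReal (G z).re ≤ w (φ z)) :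
    ENNReal.ofReal (G c).re ≤ w (φ c) := by
  have hharm : HarmonicOnNhd (fun x => (G (ψ x)).re) (φ '' closedBall c r) := fun x hx =>
    ((hG.comp_differentiableOn hψ).analyticAt
      (hU.mem_nhds (hmaps.image_subset hx))).harmonicAt_re
  have hc : c ∈ closedBall c r := mem_closedBall_self hr
  have hmin := hw.ofReal_le_of_frontier ((isCompact_closedBall c r).image_of_continuousOn hφ)
    hmaps.image_subset hharm (fun x hx => ?_) _ (mem_image_of_mem φ hc)
  · rwa [hinv.1 hc] at hmin
  · obtain ⟨z, hz, rfl⟩ := frontier_image_closedBall_subset hU hφ hmaps hψ.continuousOn hinv hx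
    rw [hinv.1 (sphere_subset_closedBall hz)]
    exact hle z hz

-- A continuous minorant of `w ∘ φ` on the circle is uniformly close to the real part of an entire
-- function `G`, and the minimum principle applies to the harmonic function `re ∘ G ∘ ψ`.
theorem IsPositiveSuperharmonicOn.circleMean_comp_le {w : ℂ → ℝ≥0∞} {U : Set ℂ}
    (hw : IsPositiveSuperharmonicOn w U) (hU : IsOpen U) {φ ψ : ℂ → ℂ} {c : ℂ} {r : ℝ}
    (hr : 0 < r) (hφ : ContinuousOn φ (closedBall c r)) (hmaps : MapsTo φ (closedBall c r) U)
    (hψ : DifferentiableOn ℂ ψ U) (hinv : InvOn ψ φ (closedBall c r) U) :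
    circleMean (w ∘ φ) c r ≤ w (φ c) := by
  refine circleMean_le_of_forall_continuous_le hr.le
    (hw.lowerSemicontinuousOn.comp (hφ.mono sphere_subset_closedBall)
      (hmaps.mono_left sphere_subset_closedBall)) fun g hg hgw => ?_
  refine ENNReal.le_of_forall_pos_le_add fun ε hε _ => ?_
  obtain ⟨G, hG, hGg⟩ := exists_differentiable_abs_sub_re_lt (g := fun z => g z) hr
    (half_pos (NNReal.coe_pos.2 hε)) (by fun_prop)
  have hGg (z) (hz : z ∈ sphere c r) : (G z).re - ε / 2 ≤ g z ∧ g z ≤ (G z).re + ε / 2 := by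
    constructor <;> linarith [abs_lt.1 (hGg z hz)]
  have hlower : ENNReal.ofReal ((G c).re - ε / 2) ≤ w (φ c) := by
    refine hw.ofReal_re_le_comp hU hr.le hφ hmaps hψ hinv (G := fun z => G z - ↑(ε / 2 : ℝ))
      (hG.sub_const _) fun z hz => (ENNReal.ofReal_le_of_le_toReal ?_).trans (hgw z hz)
    exact (hGg z hz).1
  have hharm : HarmonicOnNhd (fun z => (G z).re + ε / 2) (closedBall c r) :=
    HarmonicOnNhd.add (fun z _ => (hG.analyticAt z).harmonicAt_re) (harmonicOnNhd_const _)
  calc circleMean (fun z => g z) c r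
      ≤ circleMean (fun z => ENNReal.ofReal ((G z).re + ε / 2)) c r :=
        circleMean_mono hr.le fun z hz => by
          rw [← ENNReal.ofReal_coe_nnreal]
          exact ENNReal.ofReal_le_ofReal (hGg z hz).2
    _ = ENNReal.ofReal ((G c).re - ε / 2 + ε) := by
        rw [circleMean_ofReal hr.le (hharm.continuousOn.mono sphere_subset_closedBall)
          fun z hz => (g z).coe_nonneg.trans (hGg z hz).2,
          InnerProductSpace.HarmonicOnNhd.circleAverage_eq (by rwa [abs_of_pos hr])]
        congr 1
        ring
    _ ≤ ENNReal.ofReal ((G c).re - ε / 2) + ENNReal.ofReal ε := ENNReal.ofReal_add_le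
    _ ≤ w (φ c) + ε := by
        rw [ENNReal.ofReal_coe_nnreal]
        gcongr

/-! ### Area integrals -/

theorem lintegral_Ioo_circleMap (v : ℂ → ℝ≥0∞) (c : ℂ) (r : ℝ) :
    ∫⁻ θ in Ioo (-Real.pi) Real.pi, v (circleMap c r θ) =
      ENNReal.ofReal (2 * Real.pi) * circleMean v c r := by
  have hperiod : ∀ (g : AddSubgroup.zmultiples (2 * Real.pi)) (θ : ℝ),
      v (circleMap c r (g +ᵥ θ)) = v (circleMap c r θ) := by
    rintro ⟨_, k, rfl⟩ θ
    have := (periodic_circleMap c r).int_mul k θ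
    simp only [AddSubgroup.vadd_def, vadd_eq_add, zsmul_eq_mul] at this ⊢
    rw [add_comm, this]
  have h := (isAddFundamentalDomain_Ioc Real.two_pi_pos (-Real.pi)).setLIntegral_eq
    (isAddFundamentalDomain_Ioc Real.two_pi_pos 0) (fun θ => v (circleMap c r θ)) hperiod
  rw [zero_add, show -Real.pi + 2 * Real.pi = Real.pi by ring] at h
  rw [setLIntegral_congr Ioo_ae_eq_Ioc, h, circleMean, ← mul_assoc, ENNReal.mul_inv_cancel
    (ENNReal.ofReal_pos.2 Real.two_pi_pos).ne' ENNReal.ofReal_ne_top, one_mul]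

theorem circleMean_indicator_ball (v : ℂ → ℝ≥0∞) (c : ℂ) {r : ℝ} (hr : 0 < r) (R : ℝ) :
    circleMean ((ball c R).indicator v) c r = (Iio R).indicator (circleMean v c) r := by
  by_cases hrR : r < R
  · rw [indicator_of_mem (mem_Iio.2 hrR)]
    exact circleMean_congr hr.le fun z hz =>
      indicator_of_mem (mem_ball.2 ((mem_sphere.1 hz).trans_lt hrR)) v
  · rw [indicator_of_notMem (by simpa using hrR), ← circleMean_const 0 c r]
    refine circleMean_congr hr.le fun z hz => indicator_of_notMem (fun h => hrR ?_) v
    exact (mem_sphere.1 hz) ▸ mem_ball.1 h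

theorem lintegral_eq_lintegral_circleMean {v : ℂ → ℝ≥0∞} (hv : Measurable v) (c : ℂ) :
    ∫⁻ z, v z = ∫⁻ r in Ioi 0, ENNReal.ofReal (2 * Real.pi * r) * circleMean v c r := by
  have hsymm : ∀ p : ℝ × ℝ, c + Complex.polarCoord.symm p = circleMap c p.1 p.2 := fun p => by
    rw [Complex.polarCoord_symm_apply, circleMap, Complex.exp_mul_I]
    push_cast
    rfl
  have hmeas : Measurable fun p : ℝ × ℝ => ENNReal.ofReal p.1 * v (circleMap c p.1 p.2) :=
    (ENNReal.measurable_ofReal.comp measurable_fst).mul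
      (hv.comp (by unfold circleMap; fun_prop))
  rw [← lintegral_add_left_eq_self v c, ← Complex.lintegral_comp_polarCoord_symm]
  simp only [hsymm, smul_eq_mul]
  rw [show polarCoord.target = Ioi (0 : ℝ) ×ˢ Ioo (-Real.pi) Real.pi from rfl,
    Measure.volume_eq_prod, setLIntegral_prod _ hmeas.aemeasurable]
  refine setLIntegral_congr_fun measurableSet_Ioi fun r hr => ?_
  simp only
  rw [lintegral_const_mul' _ _ ENNReal.ofReal_ne_top, lintegral_Ioo_circleMap, ← mul_assoc,
    ← ENNReal.ofReal_mul (le_of_lt hr), mul_comm r]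

theorem setLIntegral_ball_eq_lintegral_circleMean {v : ℂ → ℝ≥0∞} (hv : Measurable v) (c : ℂ)
    (R : ℝ) :
    ∫⁻ z in ball c R, v z =
      ∫⁻ r in Ioo 0 R, ENNReal.ofReal (2 * Real.pi * r) * circleMean v c r := by
  rw [← lintegral_indicator measurableSet_ball,
    lintegral_eq_lintegral_circleMean (hv.indicator measurableSet_ball) c, ← Ioi_inter_Iio,
    inter_comm, ← setLIntegral_indicator measurableSet_Iio]
  refine setLIntegral_congr_fun measurableSet_Ioi fun r hr => ?_
  simp only [circleMean_indicator_ball v c hr, indicator_apply, mul_ite, mul_zero]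

theorem setLIntegral_ball_le_of_circleMean_le {v : ℂ → ℝ≥0∞} (hv : Measurable v) {c : ℂ} {R : ℝ}
    {M : ℝ≥0∞} (hM : ∀ r ∈ Ioo 0 R, circleMean v c r ≤ M) :
    ∫⁻ z in ball c R, v z ≤ volume (ball c R) * M := by
  calc ∫⁻ z in ball c R, v z
      = ∫⁻ r in Ioo 0 R, ENNReal.ofReal (2 * Real.pi * r) * circleMean v c r :=
        setLIntegral_ball_eq_lintegral_circleMean hv c R
    _ ≤ ∫⁻ r in Ioo 0 R, ENNReal.ofReal (2 * Real.pi * r) * circleMean (fun _ => 1) c r * M := by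
        refine setLIntegral_mono' measurableSet_Ioo fun r hr => ?_
        rw [circleMean_const, mul_one]
        gcongr
        exact hM r hr
    _ = volume (ball c R) * M := by
        rw [lintegral_mul_const, ← setLIntegral_ball_eq_lintegral_circleMean measurable_const,
          setLIntegral_one]
        simp only [circleMean_const]
        fun_prop

/-! ### Holomorphic change of variables -/

theorem abs_det_restrictScalars_toSpanSingleton (c : ℂ) :
    |((ContinuousLinearMap.toSpanSingleton ℂ c).restrictScalars ℝ).det| = ‖c‖ ^ 2 := by
  simp [ContinuousLinearMap.det, LinearMap.det_restrictScalars, Algebra.norm_complex_eq,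
    Complex.normSq_eq_norm_sq]

section ChangeOfVariables

variable {f f' : ℂ → ℂ} {s : Set ℂ}

theorem lintegral_image_eq_lintegral_enorm_sq_mul (hs : MeasurableSet s)
    (hf : ∀ z ∈ s, HasDerivWithinAt f (f' z) s z) (hinj : InjOn f s) (g : ℂ → ℝ≥0∞) :
    ∫⁻ x in f '' s, g x = ∫⁻ z in s, ‖f' z‖ₑ ^ 2 * g (f z) := by
  rw [lintegral_image_eq_lintegral_abs_det_fderiv_mul volume hs
    (fun z hz => (hf z hz).hasFDerivWithinAt.restrictScalars ℝ) hinj]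
  simp only [abs_det_restrictScalars_toSpanSingleton, ENNReal.ofReal_pow (norm_nonneg _),
    ofReal_norm]

theorem volume_image_le_lintegral_enorm_sq (hs : MeasurableSet s)
    (hf : ∀ z ∈ s, HasDerivWithinAt f (f' z) s z) :
    volume (f '' s) ≤ ∫⁻ z in s, ‖f' z‖ₑ ^ 2 := by
  refine (addHaar_image_le_lintegral_abs_det_fderiv volume hs
    fun z hz => (hf z hz).hasFDerivWithinAt.restrictScalars ℝ).trans_eq ?_
  simp only [abs_det_restrictScalars_toSpanSingleton, ENNReal.ofReal_pow (norm_nonneg _),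
    ofReal_norm]

end ChangeOfVariables

/-! ### Involutions of the disk -/

theorem mem_unitDisk {z : ℂ} : z ∈ unitDisk ↔ ‖z‖ < 1 := mem_ball_zero_iff

theorem isOpen_unitDisk : IsOpen unitDisk := isOpen_ball

/-- The holomorphic involution of the unit disk that exchanges `0` and `a`, for `‖a‖ < 1`. -/
noncomputable def diskInvolution (a z : ℂ) : ℂ := (a - z) / (1 - conj a * z)

section diskInvolution

variable {a z : ℂ}

@[simp]
theorem diskInvolution_zero : diskInvolution a 0 = a := by simp [diskInvolution]

theorem one_sub_norm_le_norm_one_sub_conj_mul (ha : ‖a‖ ≤ 1) :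
    1 - ‖z‖ ≤ ‖1 - conj a * z‖ := by
  calc 1 - ‖z‖ ≤ ‖(1 : ℂ)‖ - ‖conj a * z‖ := by
        rw [norm_one, norm_mul, RCLike.norm_conj]
        gcongr
        exact mul_le_of_le_one_left (norm_nonneg _) ha
    _ ≤ ‖1 - conj a * z‖ := norm_sub_norm_le _ _

theorem one_sub_conj_mul_ne_zero (ha : ‖a‖ ≤ 1) (hz : ‖z‖ < 1) : 1 - conj a * z ≠ 0 :=
  norm_pos_iff.1 ((sub_pos.2 hz).trans_le (one_sub_norm_le_norm_one_sub_conj_mul ha))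

theorem one_sub_norm_sq_pos (hz : ‖z‖ < 1) : 0 < 1 - ‖z‖ ^ 2 :=
  sub_pos.2 (pow_lt_one₀ (norm_nonneg z) hz two_ne_zero)

theorem one_sub_norm_diskInvolution_sq (ha : ‖a‖ ≤ 1) (hz : ‖z‖ < 1) :
    1 - ‖diskInvolution a z‖ ^ 2 =
      (1 - ‖a‖ ^ 2) * (1 - ‖z‖ ^ 2) / ‖1 - conj a * z‖ ^ 2 := by
  have h : ‖1 - conj a * z‖ ^ 2 ≠ 0 :=
    pow_ne_zero 2 (norm_ne_zero_iff.2 (one_sub_conj_mul_ne_zero ha hz))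
  rw [diskInvolution, norm_div, div_pow, eq_div_iff h, sub_mul, div_mul_cancel₀ _ h]
  simp only [← Complex.normSq_eq_norm_sq, Complex.normSq_apply, Complex.mul_re, Complex.mul_im,
    Complex.sub_re, Complex.sub_im, Complex.conj_re, Complex.conj_im, Complex.one_re,
    Complex.one_im]
  ring

theorem diskInvolution_sub (ha : ‖a‖ ≤ 1) (hz : ‖z‖ < 1) :
    diskInvolution a z - a = -(z * (1 - ‖a‖ ^ 2 : ℝ)) / (1 - conj a * z) := by
  have h := one_sub_conj_mul_ne_zero ha hz
  have hnorm : ((1 - ‖a‖ ^ 2 : ℝ) : ℂ) = 1 - conj a * a := by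
    rw [Complex.conj_mul']
    push_cast
    rfl
  rw [hnorm, diskInvolution, eq_div_iff h, sub_mul, div_mul_cancel₀ _ h]
  ring

theorem norm_diskInvolution_lt_one (ha : ‖a‖ < 1) (hz : ‖z‖ < 1) : ‖diskInvolution a z‖ < 1 := by
  have hpos : 0 < 1 - ‖diskInvolution a z‖ ^ 2 := by
    rw [one_sub_norm_diskInvolution_sq ha.le hz]
    exact div_pos (mul_pos (one_sub_norm_sq_pos ha) (one_sub_norm_sq_pos hz))
      (pow_pos (norm_pos_iff.2 (one_sub_conj_mul_ne_zero ha.le hz)) 2)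
  exact (sq_lt_one_iff₀ (norm_nonneg _)).1 (sub_pos.1 hpos)

theorem mapsTo_diskInvolution (ha : ‖a‖ < 1) : MapsTo (diskInvolution a) unitDisk unitDisk :=
  fun _ hz => mem_unitDisk.2 (norm_diskInvolution_lt_one ha (mem_unitDisk.1 hz))

theorem leftInvOn_diskInvolution (ha : ‖a‖ < 1) :
    LeftInvOn (diskInvolution a) (diskInvolution a) unitDisk := fun z hz => by
  have h := one_sub_conj_mul_ne_zero ha.le (mem_unitDisk.1 hz)
  have h' := one_sub_conj_mul_ne_zero ha.le (norm_diskInvolution_lt_one ha (mem_unitDisk.1 hz))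
  have hmul : diskInvolution a z * (1 - conj a * z) = a - z := div_mul_cancel₀ _ h
  rw [diskInvolution, div_eq_iff h']
  refine mul_right_cancel₀ h ?_
  linear_combination (conj a * z - 1) * hmul

theorem image_diskInvolution_unitDisk (ha : ‖a‖ < 1) : diskInvolution a '' unitDisk = unitDisk :=
  ((leftInvOn_diskInvolution ha).surjOn (mapsTo_diskInvolution ha)).image_eq_of_mapsTo
    (mapsTo_diskInvolution ha)

theorem differentiableOn_diskInvolution (ha : ‖a‖ ≤ 1) :
    DifferentiableOn ℂ (diskInvolution a) unitDisk := by
  unfold diskInvolution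
  exact DifferentiableOn.div (by fun_prop) (by fun_prop) fun z hz =>
    one_sub_conj_mul_ne_zero ha (mem_unitDisk.1 hz)

theorem hasDerivAt_diskInvolution (ha : ‖a‖ ≤ 1) (hz : ‖z‖ < 1) :
    HasDerivAt (diskInvolution a) (deriv (diskInvolution a) z) z :=
  ((differentiableOn_diskInvolution ha).differentiableAt
    (isOpen_unitDisk.mem_nhds (mem_unitDisk.2 hz))).hasDerivAt

theorem div_six_le_one_sub_norm_diskInvolution (ha : ‖a‖ < 1) (hz : ‖z‖ ≤ 1 / 2) :
    (1 - ‖a‖ ^ 2) / 6 ≤ 1 - ‖diskInvolution a z‖ := by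
  have hz1 : ‖z‖ < 1 := hz.trans_lt one_half_lt_one
  have hden : ‖1 - conj a * z‖ ≤ 3 / 2 := by
    refine (norm_sub_le _ _).trans ?_
    rw [norm_one, norm_mul, RCLike.norm_conj]
    nlinarith [norm_nonneg a, norm_nonneg z]
  have hsq : (1 - ‖a‖ ^ 2) / 3 ≤ 1 - ‖diskInvolution a z‖ ^ 2 := by
    rw [one_sub_norm_diskInvolution_sq ha.le hz1,
      le_div_iff₀ (pow_pos (norm_pos_iff.2 (one_sub_conj_mul_ne_zero ha.le hz1)) 2)]
    have hden2 : ‖1 - conj a * z‖ ^ 2 ≤ (3 / 2) ^ 2 := by gcongr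
    have hz2 : ‖z‖ ^ 2 ≤ (1 / 2) ^ 2 := by gcongr
    nlinarith [one_sub_norm_sq_pos ha]
  nlinarith [norm_diskInvolution_lt_one ha hz1, norm_nonneg (diskInvolution a z)]

theorem dirichletIntegral_diskInvolution (w : ℂ → ℝ≥0∞) (ha : ‖a‖ < 1) :
    dirichletIntegral w (diskInvolution a) =
      (ENNReal.ofReal Real.pi)⁻¹ * ∫⁻ z in unitDisk, w (diskInvolution a z) := by
  have hinv := leftInvOn_diskInvolution ha
  have h := lintegral_image_eq_lintegral_enorm_sq_mul isOpen_unitDisk.measurableSet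
    (fun z hz => (hasDerivAt_diskInvolution ha.le (mem_unitDisk.1 hz)).hasDerivWithinAt)
    hinv.injOn (fun z => w (diskInvolution a z))
  rw [image_diskInvolution_unitDisk ha] at h
  rw [dirichletIntegral, h]
  congr 1
  exact setLIntegral_congr_fun isOpen_unitDisk.measurableSet fun z hz => by
    simp only [hinv.eq hz]

theorem IsPositiveSuperharmonicOn.circleMean_comp_diskInvolution_le {w : ℂ → ℝ≥0∞}
    (hw : IsPositiveSuperharmonicOn w unitDisk) (ha : ‖a‖ < 1) {r : ℝ} (hr : 0 < r)
    (hr1 : r < 1) : circleMean (w ∘ diskInvolution a) 0 r ≤ w a := by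
  have hsub : closedBall (0 : ℂ) r ⊆ unitDisk := closedBall_subset_ball hr1
  have hmaps := mapsTo_diskInvolution ha
  have hinv := leftInvOn_diskInvolution ha
  have hdiff := differentiableOn_diskInvolution ha.le
  simpa only [diskInvolution_zero] using hw.circleMean_comp_le isOpen_unitDisk hr
    (hdiff.continuousOn.mono hsub) (hmaps.mono_left hsub) hdiff ⟨hinv.mono hsub, hinv⟩

theorem IsPositiveSuperharmonicOn.dirichletIntegral_diskInvolution_le {w : ℂ → ℝ≥0∞}
    (hw : IsPositiveSuperharmonicOn w unitDisk) (ha : ‖a‖ < 1) :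
    dirichletIntegral w (diskInvolution a) ≤ w a := by
  obtain ⟨v, hv, hvw⟩ := exists_measurable_eqOn (f := w ∘ diskInvolution a) (s := unitDisk)
    (hw.lowerSemicontinuousOn.comp (differentiableOn_diskInvolution ha.le).continuousOn
      (mapsTo_diskInvolution ha))
  have hmean : ∀ r ∈ Ioo (0 : ℝ) 1, circleMean v 0 r ≤ w a := fun r hr => by
    rw [circleMean_congr hr.1.le (hvw.mono (sphere_subset_ball hr.2))]
    exact hw.circleMean_comp_diskInvolution_le ha hr.1 hr.2
  have hint : ∫⁻ z in unitDisk, w (diskInvolution a z) = ∫⁻ z in unitDisk, v z :=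
    setLIntegral_congr_fun isOpen_unitDisk.measurableSet fun z hz => (hvw hz).symm
  rw [dirichletIntegral_diskInvolution w ha, hint, ENNReal.inv_mul_le_iff
    (ENNReal.ofReal_pos.2 Real.pi_pos).ne' ENNReal.ofReal_ne_top]
  refine (setLIntegral_ball_le_of_circleMean_le hv hmean).trans_eq ?_
  rw [Complex.volume_ball, ENNReal.ofReal_one, one_pow, one_mul]
  exact congrArg (· * w a) (ENNReal.ofReal_coe_nnreal (p := NNReal.pi)).symm

end diskInvolution

/-! ### Bumps -/

/-- The holomorphic bump of height `R` adapted to a point `a` close to the unit circle: the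
polynomial `R * ζ * (ζ - a)` composed with the involution that exchanges `0` and `a`. The zero at
`ζ = a` makes it small on compact subsets of the disk. -/
noncomputable def diskBump (R : ℝ) (a z : ℂ) : ℂ :=
  R * (diskInvolution a z * (diskInvolution a z - a))

section diskBump

variable {R : ℝ} {a z : ℂ}

theorem differentiableOn_diskBump (ha : ‖a‖ ≤ 1) : DifferentiableOn ℂ (diskBump R a) unitDisk :=
  ((differentiableOn_diskInvolution ha).mul
    ((differentiableOn_diskInvolution ha).sub_const a)).const_mul _

theorem diskBump_diskInvolution (ha : ‖a‖ < 1) (hz : ‖z‖ < 1) :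
    diskBump R a (diskInvolution a z) = R * (z * (z - a)) := by
  rw [diskBump, (leftInvOn_diskInvolution ha).eq (mem_unitDisk.2 hz)]

theorem norm_diskBump_le_mul_norm_sub (hR : 0 ≤ R) (ha : ‖a‖ < 1) (hz : ‖z‖ < 1) :
    ‖diskBump R a z‖ ≤ R * ‖diskInvolution a z - a‖ := by
  rw [diskBump, norm_mul, norm_mul, Complex.norm_real, Real.norm_of_nonneg hR]
  gcongr
  exact mul_le_of_le_one_left (norm_nonneg _) (norm_diskInvolution_lt_one ha hz).le

theorem norm_diskBump_le_two_mul (hR : 0 ≤ R) (ha : ‖a‖ < 1) (hz : ‖z‖ < 1) :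
    ‖diskBump R a z‖ ≤ 2 * R := by
  refine (norm_diskBump_le_mul_norm_sub hR ha hz).trans ?_
  rw [mul_comm]
  gcongr
  linarith [norm_sub_le (diskInvolution a z) a, norm_diskInvolution_lt_one ha hz]

theorem norm_diskBump_le_div (hR : 0 ≤ R) (ha : ‖a‖ < 1) (hz : ‖z‖ < 1) :
    ‖diskBump R a z‖ ≤ R * (1 - ‖a‖ ^ 2) / (1 - ‖z‖) := by
  have ha2 : 0 ≤ 1 - ‖a‖ ^ 2 := (one_sub_norm_sq_pos ha).le
  have := sub_pos.2 hz
  refine (norm_diskBump_le_mul_norm_sub hR ha hz).trans ?_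
  rw [diskInvolution_sub ha.le hz, norm_div, norm_neg, norm_mul, Complex.norm_real,
    Real.norm_of_nonneg ha2, mul_div_assoc R]
  gcongr
  · exact mul_le_of_le_one_left ha2 hz.le
  · exact one_sub_norm_le_norm_one_sub_conj_mul ha.le

theorem deriv_diskBump (ha : ‖a‖ ≤ 1) (hz : ‖z‖ < 1) :
    deriv (diskBump R a) z =
      R * (2 * diskInvolution a z - a) * deriv (diskInvolution a) z := by
  have hd := hasDerivAt_diskInvolution ha hz
  have h : HasDerivAt (diskBump R a) _ z := (hd.mul (hd.sub_const a)).const_mul (R : ℂ)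
  rw [h.deriv]
  ring

theorem norm_deriv_diskBump_le (hR : 0 ≤ R) (ha : ‖a‖ < 1) (hz : ‖z‖ < 1) :
    ‖deriv (diskBump R a) z‖ ≤ 3 * R * ‖deriv (diskInvolution a) z‖ := by
  have h : ‖2 * diskInvolution a z - a‖ ≤ 3 := by
    refine (norm_sub_le _ _).trans ?_
    rw [norm_mul, Complex.norm_ofNat]
    linarith [norm_diskInvolution_lt_one ha hz]
  rw [deriv_diskBump ha.le hz, norm_mul, norm_mul, Complex.norm_real, Real.norm_of_nonneg hR,
    mul_comm 3]
  gcongr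

theorem dirichletIntegral_le_of_norm_deriv_le (w : ℂ → ℝ≥0∞) {f g : ℂ → ℂ} {C : ℝ}
    (h : ∀ z ∈ unitDisk, ‖deriv f z‖ ≤ C * ‖deriv g z‖) :
    dirichletIntegral w f ≤ ENNReal.ofReal C ^ 2 * dirichletIntegral w g := by
  rw [dirichletIntegral, dirichletIntegral, mul_left_comm,
    ← lintegral_const_mul' _ _ (ENNReal.pow_ne_top ENNReal.ofReal_ne_top)]
  gcongr 1
  refine setLIntegral_mono' isOpen_unitDisk.measurableSet fun z hz => ?_
  rw [← mul_assoc, ← mul_pow]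
  gcongr
  rw [← ofReal_norm, ← ofReal_norm, ← ENNReal.ofReal_mul' (norm_nonneg _)]
  exact ENNReal.ofReal_le_ofReal (h z hz)

theorem IsPositiveSuperharmonicOn.dirichletIntegral_diskBump_le {w : ℂ → ℝ≥0∞}
    (hw : IsPositiveSuperharmonicOn w unitDisk) (hR : 0 ≤ R) (ha : ‖a‖ < 1) :
    dirichletIntegral w (diskBump R a) ≤ ENNReal.ofReal (3 * R) ^ 2 * w a :=
  (dirichletIntegral_le_of_norm_deriv_le w fun _ hz =>
    norm_deriv_diskBump_le hR ha (mem_unitDisk.1 hz)).trans <| by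
      gcongr
      exact hw.dirichletIntegral_diskInvolution_le ha

end diskBump

theorem sq_tsum_le_four_mul_tsum (x : ℕ → ℝ≥0∞) :
    (∑' k, x k) ^ 2 ≤ 4 * ∑' k, 4 ^ k * x k ^ 2 := by
  set S := ⨆ k, 2 ^ k * x k
  have hterm : ∀ k, x k ≤ 2⁻¹ ^ k * S := fun k =>
    calc x k = 2⁻¹ ^ k * (2 ^ k * x k) := by
          rw [← mul_assoc, ← mul_pow, ENNReal.inv_mul_cancel two_ne_zero ENNReal.ofNat_ne_top,
            one_pow, one_mul]
      _ ≤ 2⁻¹ ^ k * S := by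
          gcongr
          exact le_iSup (fun k => 2 ^ k * x k) k
  have hS : S ^ 2 ≤ ∑' k, 4 ^ k * x k ^ 2 := by
    rw [ENNReal.iSup_pow]
    refine iSup_le fun k => le_of_eq_of_le ?_ (ENNReal.le_tsum k)
    rw [mul_pow, ← pow_mul, mul_comm k, pow_mul]
    norm_num
  calc (∑' k, x k) ^ 2 ≤ (∑' k, 2⁻¹ ^ k * S) ^ 2 := by
        gcongr with k
        exact hterm k
    _ = 4 * S ^ 2 := by
        rw [ENNReal.tsum_mul_right, ENNReal.tsum_geometric, ENNReal.one_sub_inv_two, inv_inv,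
          mul_pow]
        norm_num
    _ ≤ 4 * ∑' k, 4 ^ k * x k ^ 2 := by gcongr

theorem dirichletIntegral_le_tsum {w : ℂ → ℝ≥0∞} (hw : AEMeasurable w (volume.restrict unitDisk))
    {f : ℂ → ℂ} {g : ℕ → ℂ → ℂ}
    (hfg : ∀ z ∈ unitDisk, HasSum (fun k => deriv (g k) z) (deriv f z)) :
    dirichletIntegral w f ≤ 4 * ∑' k, 4 ^ k * dirichletIntegral w (g k) := by
  have hpoint : ∀ z ∈ unitDisk,
      ‖deriv f z‖ₑ ^ 2 * w z ≤ 4 * ∑' k, 4 ^ k * (‖deriv (g k) z‖ₑ ^ 2 * w z) := fun z hz =>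
    calc ‖deriv f z‖ₑ ^ 2 * w z
        ≤ (∑' k, ‖deriv (g k) z‖ₑ) ^ 2 * w z := by
          rw [← (hfg z hz).tsum_eq]
          gcongr
          exact enorm_tsum_le_tsum_enorm
      _ ≤ 4 * (∑' k, 4 ^ k * ‖deriv (g k) z‖ₑ ^ 2) * w z := by
          gcongr
          exact sq_tsum_le_four_mul_tsum _
      _ = 4 * ∑' k, 4 ^ k * (‖deriv (g k) z‖ₑ ^ 2 * w z) := by
          simp only [← mul_assoc, ENNReal.tsum_mul_right]
  have hmeas : ∀ k, AEMeasurable (fun z => ‖deriv (g k) z‖ₑ ^ 2 * w z)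
      (volume.restrict unitDisk) := fun k =>
    ((measurable_deriv (g k)).enorm.pow_const 2).aemeasurable.mul hw
  have hfour : ∀ k : ℕ, (4 : ℝ≥0∞) ^ k ≠ ∞ := fun k => ENNReal.pow_ne_top ENNReal.ofNat_ne_top
  calc dirichletIntegral w f
      ≤ (ENNReal.ofReal Real.pi)⁻¹ *
          ∫⁻ z in unitDisk, 4 * ∑' k, 4 ^ k * (‖deriv (g k) z‖ₑ ^ 2 * w z) := by
        rw [dirichletIntegral]
        gcongr 1
        exact setLIntegral_mono' isOpen_unitDisk.measurableSet hpoint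
    _ = 4 * ∑' k, 4 ^ k * dirichletIntegral w (g k) := by
        rw [lintegral_const_mul' _ _ ENNReal.ofNat_ne_top,
          lintegral_tsum fun k => (hmeas k).const_mul _, mul_left_comm, ← ENNReal.tsum_mul_left]
        simp only [lintegral_const_mul' _ _ (hfour _), dirichletIntegral, mul_left_comm]

/-! ### Covering a disk -/

theorem ball_subset_image_closedBall_of_le_norm_sub {F : ℂ → ℂ} {c : ℂ} {r ε : ℝ}
    (hF : DiffContOnCl ℂ F (ball c r)) (hr : 0 < r) (hε : 0 < ε)
    (hsphere : ∀ z ∈ sphere c r, ε ≤ ‖F z - F c‖) :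
    ball (F c) (ε / 2) ⊆ F '' closedBall c r := by
  refine hF.ball_subset_image_closedBall hr hsphere fun hconst => ?_
  have hball : EqOn F (fun _ => F c) (ball c r) :=
    (hF.differentiableOn.analyticOnNhd isOpen_ball).eqOn_of_preconnected_of_eventuallyEq
      analyticOnNhd_const (convex_ball c r).isPreconnected (mem_ball_self hr)
      (hconst.mono fun z hz => not_not.1 hz)
  obtain ⟨z, hz⟩ := NormedSpace.sphere_nonempty (x := c).2 hr.le
  have hFz : F z = F c := hball.of_subset_closure hF.continuousOn continuousOn_const
    subset_closure subset_rfl (by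
      rw [closure_ball c hr.ne']
      exact sphere_subset_closedBall hz)
  have := hsphere z hz
  rw [hFz, sub_self, norm_zero] at this
  exact this.not_gt hε

theorem ball_subset_image_of_norm_sub_mul_le {F : ℂ → ℂ} (hF : DiffContOnCl ℂ F (ball 0 (1 / 2)))
    {R : ℝ} (hR : 0 < R) {a : ℂ} (ha : 3 / 4 ≤ ‖a‖)
    (h : ∀ z ∈ closedBall 0 (1 / 2), ‖F z - R * (z * (z - a))‖ ≤ R / 64) :
    ball 0 (R / 32) ⊆ F '' closedBall 0 (1 / 2) := by
  have hF0 : ‖F 0‖ ≤ R / 64 := by simpa using h 0 (by simp)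
  have hsphere : ∀ z ∈ sphere (0 : ℂ) (1 / 2), 3 * R / 32 ≤ ‖F z - F 0‖ := fun z hz => by
    have hz' : ‖z‖ = 1 / 2 := mem_sphere_zero_iff_norm.1 hz
    have hza : 1 / 4 ≤ ‖z - a‖ := by
      linarith [norm_sub_norm_le a z, norm_sub_rev a z]
    have hpoly : R / 8 ≤ ‖R * (z * (z - a))‖ := by
      rw [norm_mul, norm_mul, Complex.norm_real, Real.norm_of_nonneg hR.le, hz']
      nlinarith
    linarith [h z (sphere_subset_closedBall hz), norm_sub_norm_le (F z) (F 0),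
      norm_sub_norm_le (R * (z * (z - a))) (F z), norm_sub_rev (R * (z * (z - a))) (F z)]
  refine Subset.trans (fun c hc => ?_) (ball_subset_image_closedBall_of_le_norm_sub hF
    one_half_pos (by positivity) hsphere)
  rw [mem_ball_zero_iff] at hc
  rw [mem_ball_iff_norm]
  linarith [norm_sub_le c (F 0)]

/-! ### Sums of bumps -/

theorem one_le_of_sum_range_le {R : ℕ → ℝ}
    (hR : ∀ k, 128 * (∑ j ∈ Finset.range k, R j + 1) ≤ R k) (k : ℕ) : 1 ≤ R k := by
  induction k using Nat.strong_induction_on with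
  | _ k ih =>
    have hsum : 0 ≤ ∑ j ∈ Finset.range k, R j :=
      Finset.sum_nonneg fun j hj => zero_le_one.trans (ih j (Finset.mem_range.1 hj))
    linarith [hR k]

/-- Heights `R` and points `a` of the disk such that the bumps `diskBump (R k) (a k)` hardly
interact: near `a k`, the earlier bumps are negligible because the heights grow fast, and the later
ones because the points approach the unit circle fast. -/
structure IsLacunary (R : ℕ → ℝ) (a : ℕ → ℂ) : Prop where
  norm_lt_one : ∀ k, ‖a k‖ < 1
  sum_le : ∀ k, 128 * (∑ j ∈ Finset.range k, R j + 1) ≤ R k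
  mul_le : ∀ k, R k * (1 - ‖a k‖ ^ 2) ≤ (1 / 2) ^ k / 6
  mul_le_mul : ∀ j k, j < k → R k * (1 - ‖a k‖ ^ 2) ≤ (1 / 2) ^ k / 6 * (1 - ‖a j‖ ^ 2)

namespace IsLacunary

variable {R : ℕ → ℝ} {a : ℕ → ℂ}

theorem height_pos (h : IsLacunary R a) (k : ℕ) : 0 < R k :=
  one_pos.trans_le (one_le_of_sum_range_le h.sum_le k)

theorem mul_succ_le_height (h : IsLacunary R a) (k : ℕ) : 128 * (k + 1 : ℝ) ≤ R k := by
  have hsum : (k : ℝ) ≤ ∑ j ∈ Finset.range k, R j := by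
    simpa using Finset.sum_le_sum fun j (_ : j ∈ Finset.range k) =>
      one_le_of_sum_range_le h.sum_le j
  linarith [h.sum_le k]

theorem three_div_four_le_norm (h : IsLacunary R a) (k : ℕ) : 3 / 4 ≤ ‖a k‖ := by
  have hpow : ((1 : ℝ) / 2) ^ k ≤ 1 := pow_le_one₀ one_half_pos.le one_half_lt_one.le
  nlinarith [h.mul_le k, h.mul_succ_le_height k, one_sub_norm_sq_pos (h.norm_lt_one k),
    norm_nonneg (a k), k.cast_nonneg (α := ℝ)]

theorem norm_diskBump_le (h : IsLacunary R a) {ρ : ℝ} (hρ : ρ < 1) (k : ℕ) {z : ℂ}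
    (hz : z ∈ ball 0 ρ) : ‖diskBump (R k) (a k) z‖ ≤ (1 / 2) ^ k / (1 - ρ) := by
  have hzρ : ‖z‖ < ρ := mem_ball_zero_iff.1 hz
  have := sub_pos.2 hρ
  refine (norm_diskBump_le_div (h.height_pos k).le (h.norm_lt_one k) (hzρ.trans hρ)).trans ?_
  gcongr
  exact (h.mul_le k).trans (div_le_self (by positivity) (by norm_num))

theorem summable_diskBump (h : IsLacunary R a) {z : ℂ} (hz : z ∈ unitDisk) :
    Summable fun k => diskBump (R k) (a k) z := by
  obtain ⟨ρ, hzρ, hρ⟩ := exists_between (mem_unitDisk.1 hz)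
  exact .of_norm_bounded (summable_geometric_two.div_const (1 - ρ)) fun k =>
    h.norm_diskBump_le hρ k (mem_ball_zero_iff.2 hzρ)

theorem differentiableOn_tsum (h : IsLacunary R a) :
    DifferentiableOn ℂ (fun z => ∑' k, diskBump (R k) (a k) z) unitDisk := fun z hz => by
  obtain ⟨ρ, hzρ, hρ⟩ := exists_between (mem_unitDisk.1 hz)
  exact ((Complex.differentiableOn_tsum_of_summable_norm
    (summable_geometric_two.div_const (1 - ρ))
    (fun k => (differentiableOn_diskBump (h.norm_lt_one k).le).mono (ball_subset_ball hρ.le))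
    isOpen_ball fun k x hx => h.norm_diskBump_le hρ k hx).differentiableAt
      (isOpen_ball.mem_nhds (mem_ball_zero_iff.2 hzρ))).differentiableWithinAt

theorem hasSum_deriv (h : IsLacunary R a) {z : ℂ} (hz : z ∈ unitDisk) :
    HasSum (fun k => deriv (diskBump (R k) (a k)) z)
      (deriv (fun z => ∑' k, diskBump (R k) (a k) z) z) := by
  obtain ⟨ρ, hzρ, hρ⟩ := exists_between (mem_unitDisk.1 hz)
  exact Complex.hasSum_deriv_of_summable_norm (summable_geometric_two.div_const (1 - ρ))
    (fun k => (differentiableOn_diskBump (h.norm_lt_one k).le).mono (ball_subset_ball hρ.le))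
    isOpen_ball (fun k x hx => h.norm_diskBump_le hρ k hx) (mem_ball_zero_iff.2 hzρ)

theorem norm_diskBump_diskInvolution_le (h : IsLacunary R a) {j k : ℕ} (hkj : k < j) {z : ℂ}
    (hz : ‖z‖ ≤ 1 / 2) :
    ‖diskBump (R j) (a j) (diskInvolution (a k) z)‖ ≤ (1 / 2) ^ j := by
  have hk := h.norm_lt_one k
  have hx := norm_diskInvolution_lt_one hk (hz.trans_lt one_half_lt_one)
  refine (norm_diskBump_le_div (h.height_pos j).le (h.norm_lt_one j) hx).trans ?_
  rw [div_le_iff₀ (sub_pos.2 hx)]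
  calc R j * (1 - ‖a j‖ ^ 2) ≤ (1 / 2) ^ j / 6 * (1 - ‖a k‖ ^ 2) := h.mul_le_mul k j hkj
    _ = (1 / 2) ^ j * ((1 - ‖a k‖ ^ 2) / 6) := by ring
    _ ≤ (1 / 2) ^ j * (1 - ‖diskInvolution (a k) z‖) := by
        gcongr
        exact div_six_le_one_sub_norm_diskInvolution hk hz

theorem norm_tsum_sub_le (h : IsLacunary R a) (k : ℕ) {z : ℂ} (hz : ‖z‖ ≤ 1 / 2) :
    ‖∑' j, diskBump (R j) (a j) (diskInvolution (a k) z) - R k * (z * (z - a k))‖ ≤ R k / 64 := by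
  have hk := h.norm_lt_one k
  have hz1 : ‖z‖ < 1 := hz.trans_lt one_half_lt_one
  set x := diskInvolution (a k) z with hx
  have hx1 : ‖x‖ < 1 := norm_diskInvolution_lt_one hk hz1
  have hearlier : ‖∑ j ∈ Finset.range k, diskBump (R j) (a j) x‖ ≤
      2 * ∑ j ∈ Finset.range k, R j := by
    rw [Finset.mul_sum]
    exact norm_sum_le_of_le _ fun j _ =>
      norm_diskBump_le_two_mul (h.height_pos j).le (h.norm_lt_one j) hx1
  have hlater : ‖∑' i, diskBump (R (i + (k + 1))) (a (i + (k + 1))) x‖ ≤ 2 :=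
    tsum_of_norm_bounded hasSum_geometric_two fun i =>
      (h.norm_diskBump_diskInvolution_le (by omega) hz).trans
        (pow_le_pow_of_le_one one_half_pos.le one_half_lt_one.le (by omega))
  calc ‖∑' j, diskBump (R j) (a j) x - R k * (z * (z - a k))‖
      = ‖∑ j ∈ Finset.range k, diskBump (R j) (a j) x +
          ∑' i, diskBump (R (i + (k + 1))) (a (i + (k + 1))) x‖ := by
        rw [← (h.summable_diskBump (mem_unitDisk.2 hx1)).sum_add_tsum_nat_add (k + 1),
          Finset.sum_range_succ, ← diskBump_diskInvolution hk hz1, ← hx,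
          add_right_comm, add_sub_cancel_right]
    _ ≤ 2 * ∑ j ∈ Finset.range k, R j + 2 := (norm_add_le _ _).trans (add_le_add hearlier hlater)
    _ ≤ R k / 64 := by linarith [h.sum_le k]

theorem image_tsum_eq_univ (h : IsLacunary R a) :
    (fun z => ∑' k, diskBump (R k) (a k) z) '' unitDisk = univ := by
  refine eq_univ_of_forall fun c => ?_
  obtain ⟨k, hk⟩ := exists_nat_ge ‖c‖
  have hak := h.norm_lt_one k
  have hsub : closedBall (0 : ℂ) (1 / 2) ⊆ unitDisk := closedBall_subset_ball one_half_lt_one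
  have hdiff : DiffContOnCl ℂ (fun z => ∑' j, diskBump (R j) (a j) (diskInvolution (a k) z))
      (ball 0 (1 / 2)) :=
    ((h.differentiableOn_tsum.comp (differentiableOn_diskInvolution hak.le)
      (mapsTo_diskInvolution hak)).mono (closure_ball_subset_closedBall.trans hsub)).diffContOnCl
  have hc : c ∈ ball 0 (R k / 32) := by
    rw [mem_ball_zero_iff]
    linarith [h.mul_succ_le_height k, norm_nonneg c]
  obtain ⟨z, hz, rfl⟩ := ball_subset_image_of_norm_sub_mul_le hdiff (h.height_pos k)
    (h.three_div_four_le_norm k)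
    (fun z hz => h.norm_tsum_sub_le k (mem_closedBall_zero_iff.1 hz)) hc
  exact ⟨diskInvolution (a k) z, mapsTo_diskInvolution hak (hsub hz), rfl⟩

end IsLacunary

/-! ### Existence of a surjective function -/

section Existence

variable {w : ℂ → ℝ≥0∞}

theorem exists_lt_one_sub_norm_sq_le (hw : LowerSemicontinuousOn w unitDisk)
    (hpos : ∀ z ∈ unitDisk, 0 < w z) (hinf : (⨅ z ∈ unitDisk, w z) = 0) {ε : ℝ≥0∞} (hε : 0 < ε)
    {η : ℝ} (hη : 0 < η) : ∃ a, ‖a‖ < 1 ∧ w a < ε ∧ 1 - ‖a‖ ^ 2 ≤ η := by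
  set s : ℝ := max (1 - η / 2) 0
  have hs0 : 0 ≤ s := le_max_right _ _
  have hs1 : s < 1 := max_lt (by linarith) one_pos
  have hsub : closedBall (0 : ℂ) s ⊆ unitDisk := closedBall_subset_ball hs1
  obtain ⟨x, hx, hmin⟩ := (hw.mono hsub).exists_isMinOn (nonempty_closedBall.2 hs0)
    (isCompact_closedBall (0 : ℂ) s)
  have hlt : ⨅ z ∈ unitDisk, w z < min ε (w x) := hinf ▸ lt_min hε (hpos x (hsub hx))
  obtain ⟨a, ha, hwa⟩ := by simpa only [iInf_lt_iff, exists_prop] using hlt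
  have hsa : s < ‖a‖ := by
    by_contra! has
    exact (hmin (mem_closedBall_zero_iff.2 has)).not_gt (hwa.trans_le (min_le_right _ _))
  have ha1 : ‖a‖ < 1 := mem_unitDisk.1 ha
  refine ⟨a, ha1, hwa.trans_le (min_le_left _ _), ?_⟩
  nlinarith [le_max_left (1 - η / 2) 0, norm_nonneg a]

theorem exists_isLacunary (hw : LowerSemicontinuousOn w unitDisk)
    (hpos : ∀ z ∈ unitDisk, 0 < w z) (hinf : (⨅ z ∈ unitDisk, w z) = 0) {ε : ℕ → ℝ≥0∞}
    (hε : ∀ k, 0 < ε k) {R : ℕ → ℝ}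
    (hR : ∀ k, 128 * (∑ j ∈ Finset.range k, R j + 1) ≤ R k) :
    ∃ a, IsLacunary R a ∧ ∀ k, w (a k) < ε k := by
  have hstep : ∀ (k : ℕ) (d : {d : ℝ // 0 < d}), ∃ a, ‖a‖ < 1 ∧ w a < ε k ∧
      R k * (1 - ‖a‖ ^ 2) ≤ (1 / 2) ^ k / 6 * d := fun k d => by
    have hRk := one_pos.trans_le (one_le_of_sum_range_le hR k)
    have hd := d.2
    obtain ⟨a, ha, hwa, hle⟩ := exists_lt_one_sub_norm_sq_le hw hpos hinf (hε k)
      (η := (1 / 2) ^ k / 6 * d / R k) (by positivity)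
    exact ⟨a, ha, hwa, (le_div_iff₀' hRk).1 hle⟩
  choose A hA hwA hRA using hstep
  let d : ℕ → {d : ℝ // 0 < d} := fun k =>
    k.rec ⟨1, one_pos⟩ fun k d => ⟨1 - ‖A k d‖ ^ 2, one_sub_norm_sq_pos (hA k d)⟩
  have hanti : Antitone fun k => (d k).1 := antitone_nat_of_succ_le fun k => by
    have hle : R k * (d (k + 1)).1 ≤ (1 / 2) ^ k / 6 * (d k).1 :=
      hRA k (d k)
    have hpow : ((1 : ℝ) / 2) ^ k ≤ 1 := pow_le_one₀ one_half_pos.le one_half_lt_one.le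
    nlinarith [(d k).2, (d (k + 1)).2, one_le_of_sum_range_le hR k]
  refine ⟨fun k => A k (d k), ⟨fun k => hA k _, hR, fun k => (hRA k (d k)).trans ?_,
    fun j k hjk => (hRA k (d k)).trans ?_⟩, fun k => hwA k _⟩
  · exact mul_le_of_le_one_right (by positivity) (hanti k.zero_le)
  · gcongr
    exact hanti (Nat.succ_le_of_lt hjk)

theorem sum_pow_succ_add_one_le (k : ℕ) :
    128 * (∑ j ∈ Finset.range k, (256 : ℝ) ^ (j + 1) + 1) ≤ 256 ^ (k + 1) := by
  induction k with
  | zero => norm_num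
  | succ k ih =>
    rw [Finset.sum_range_succ, pow_succ _ (k + 1)]
    linarith [pow_pos (show (0 : ℝ) < 256 by norm_num) (k + 1)]

theorem IsPositiveSuperharmonicOn.exists_mem_dirichletSpace_image_eq_univ
    (hw : IsPositiveSuperharmonicOn w unitDisk) (hinf : (⨅ z ∈ unitDisk, w z) = 0) :
    ∃ f ∈ dirichletSpace w, f '' unitDisk = univ := by
  set R : ℕ → ℝ := fun k => 256 ^ (k + 1)
  set C : ℕ → ℝ≥0∞ := fun k => 4 ^ k * ENNReal.ofReal (3 * R k) ^ 2
  obtain ⟨ε, hε, hsum⟩ := ENNReal.exists_pos_tsum_mul_lt_of_countable one_ne_zero C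
    fun k => by finiteness
  obtain ⟨a, ha, hwa⟩ := exists_isLacunary hw.lowerSemicontinuousOn hw.pos hinf
    (fun k => ENNReal.coe_pos.2 (hε k)) (R := R) sum_pow_succ_add_one_le
  obtain ⟨v, hv, hvw⟩ := exists_measurable_eqOn hw.lowerSemicontinuousOn
  have hmeas : AEMeasurable w (volume.restrict unitDisk) :=
    ⟨v, hv, (ae_restrict_mem isOpen_unitDisk.measurableSet).mono fun z hz => (hvw hz).symm⟩
  have hterm : ∀ k, 4 ^ k * dirichletIntegral w (diskBump (R k) (a k)) ≤ C k * ε k := fun k => by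
    rw [mul_assoc]
    gcongr
    refine (hw.dirichletIntegral_diskBump_le (ha.height_pos k).le (ha.norm_lt_one k)).trans ?_
    gcongr
    exact (hwa k).le
  refine ⟨_, ⟨ha.differentiableOn_tsum, ?_⟩, ha.image_tsum_eq_univ⟩
  calc dirichletIntegral w (fun z => ∑' k, diskBump (R k) (a k) z)
      ≤ 4 * ∑' k, 4 ^ k * dirichletIntegral w (diskBump (R k) (a k)) :=
        dirichletIntegral_le_tsum hmeas fun z hz => ha.hasSum_deriv hz
    _ ≤ 4 * ∑' k, C k * ε k := mul_le_mul_right (ENNReal.tsum_le_tsum hterm) 4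
    _ < ∞ := ENNReal.mul_lt_top ENNReal.ofNat_lt_top (hsum.trans ENNReal.one_lt_top)

end Existence

/-! ### The area of the image -/

theorem volume_image_unitDisk_le {f : ℂ → ℂ} (hf : DifferentiableOn ℂ f unitDisk) :
    volume (f '' unitDisk) ≤ ∫⁻ z in unitDisk, ‖deriv f z‖ₑ ^ 2 :=
  volume_image_le_lintegral_enorm_sq isOpen_unitDisk.measurableSet fun _ hz =>
    (hf.differentiableAt (isOpen_unitDisk.mem_nhds hz)).hasDerivAt.hasDerivWithinAt

theorem iInf_mul_lintegral_le_dirichletIntegral (w : ℂ → ℝ≥0∞) (f : ℂ → ℂ) :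
    (ENNReal.ofReal Real.pi)⁻¹ * ((⨅ z ∈ unitDisk, w z) * ∫⁻ z in unitDisk, ‖deriv f z‖ₑ ^ 2) ≤
      dirichletIntegral w f := by
  rw [dirichletIntegral, mul_comm (⨅ z ∈ unitDisk, w z),
    ← lintegral_mul_const _ ((measurable_deriv f).enorm.pow_const 2)]
  gcongr 1
  exact setLIntegral_mono' isOpen_unitDisk.measurableSet fun z hz => by
    gcongr
    exact iInf₂_le z hz

theorem iInf_eq_zero_of_mem_dirichletSpace {w : ℂ → ℝ≥0∞} {f : ℂ → ℂ}
    (hf : f ∈ dirichletSpace w) (hsurj : f '' unitDisk = univ) :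
    (⨅ z ∈ unitDisk, w z) = 0 := by
  have harea : ∫⁻ z in unitDisk, ‖deriv f z‖ₑ ^ 2 = ∞ := by
    simpa [hsurj] using volume_image_unitDisk_le hf.1
  by_contra hne
  refine ((iInf_mul_lintegral_le_dirichletIntegral w f).trans_lt hf.2).ne ?_
  rw [harea, ENNReal.mul_top hne,
    ENNReal.mul_top (ENNReal.inv_ne_zero.2 ENNReal.ofReal_ne_top)]

theorem theorem4 (w : ℂ → ℝ≥0∞) (hw : IsPositiveSuperharmonicOn w unitDisk) :
    (∃ f ∈ dirichletSpace w, f '' unitDisk = Set.univ) ↔ (⨅ z ∈ unitDisk, w z) = 0 :=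
  ⟨fun ⟨_, hf, hsurj⟩ => iInf_eq_zero_of_mem_dirichletSpace hf hsurj,
    hw.exists_mem_dirichletSpace_image_eq_univ⟩
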